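/- Let $n$ be a natural number and let $A,B,C,D$ be positive definite $n\times n$ complex matrices. For positive definite $X,Y$ let $$X\sharp Y = X^{1/2}\left(X^{-1/2}\,Y\,X^{-1/2}\right)^{1/2}X^{1/2}$$ denote their geometric mean. Then for every unitarily invariant norm $|||\cdot|||$ on the space of $n\times n$ complex matrices (that is, every norm with $|||UXV|||=|||X|||$ for all matrices $X$ and all unitary matrices $U,V$), $$|||A\sharp B+C\sharp D|||\le\left|\left|\left|\left((A+C)^{1/2}(B+D)(A+C)^{1/2}\right)^{1/2}\right|\right|\right|.$$ -/

import Mathlib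

open scoped MatrixOrder ComplexOrder

/-- A unitarily invariant norm on the space of `n × n` complex matrices: a norm `N` with
`N (U * X * V) = N X` for all matrices `X` and all unitary matrices `U`, `V`. -/
structure UnitarilyInvariantNorm (n : ℕ) extends Seminorm ℂ (Matrix (Fin n) (Fin n) ℂ) where
  eq_zero_of_map_eq_zero' : ∀ X : Matrix (Fin n) (Fin n) ℂ, toFun X = 0 → X = 0
  map_unitary_mul_mul_unitary' : ∀ (X U V : Matrix (Fin n) (Fin n) ℂ),
    U ∈ Matrix.unitaryGroup (Fin n) ℂ → V ∈ Matrix.unitaryGroup (Fin n) ℂ →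
      toFun (U * X * V) = toFun X

instance (n : ℕ) : CoeFun (UnitarilyInvariantNorm n) fun _ => Matrix (Fin n) (Fin n) ℂ → ℝ where
  coe N := N.toFun

/-- The geometric mean `A ♯ B = A^{1/2} (A^{-1/2} B A^{-1/2})^{1/2} A^{1/2}` of two positive
definite matrices; the real powers are those of the continuous functional calculus. -/
noncomputable def matGeomMean {n : ℕ} (A B : Matrix (Fin n) (Fin n) ℂ) :
    Matrix (Fin n) (Fin n) ℂ :=
  A ^ (1 / 2 : ℝ) * (A ^ (-(1 / 2) : ℝ) * B * A ^ (-(1 / 2) : ℝ)) ^ (1 / 2 : ℝ) * A ^ (1 / 2 : ℝ)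

infixl:70 " ♯ " => matGeomMean

/-! ### Pinching. -/

namespace UnitarilyInvariantNorm

open Matrix

variable {n : ℕ} (N : UnitarilyInvariantNorm n)

/-! Write P = A + C, Q = B + D, S = A ♯ B + C ♯ D, p = P^{1/2}, K = (pQp)^{1/2}. Since G = A ♯ B
satisfies G A⁻¹ G = B, joint convexity of (G, A) ↦ G A⁻¹ G gives S P⁻¹ S ≤ Q
(`PosDef.posSemidef_add_sub_matGeomMean`). Put T = p S p⁻¹. Then T T* = p S P⁻¹ S p ≤ K², so T is K
times a contraction and N T ≤ N K. Also N S ≤ N T (`map_hermitian_le_map_conj`): T is unitarily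
similar to a triangular matrix with the eigenvalues of S on its diagonal, and pinching to the
diagonal does not increase N. -/

theorem map_mul_unitary (X : Matrix (Fin n) (Fin n) ℂ) {V : Matrix (Fin n) (Fin n) ℂ}
    (hV : V ∈ unitaryGroup (Fin n) ℂ) : N (X * V) = N X := by
  simpa using N.map_unitary_mul_mul_unitary' X 1 V (one_mem _) hV

theorem map_smul (c : ℂ) (X : Matrix (Fin n) (Fin n) ℂ) : N (c • X) = ‖c‖ * N X :=
  map_smul_eq_mul N.toSeminorm c X

theorem map_add_le (X Y : Matrix (Fin n) (Fin n) ℂ) : N (X + Y) ≤ N X + N Y :=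
  map_add_le_add N.toSeminorm X Y

theorem map_sum_le {ι : Type*} (s : Finset ι) (f : ι → Matrix (Fin n) (Fin n) ℂ) :
    N (∑ i ∈ s, f i) ≤ ∑ i ∈ s, N (f i) :=
  Finset.le_sum_of_subadditive (fun X => N X) (map_zero N.toSeminorm).le N.map_add_le s f

/-- Pinching to the diagonal does not increase a unitarily invariant norm. -/
theorem map_diagonal_diag_le (Y : Matrix (Fin n) (Fin n) ℂ) :
    N (diagonal Y.diag) ≤ N Y := by
  -- Order n + 1 rather than n also covers n = 0; the powers with exponent below n stay distinct.
  have hω := Complex.isPrimitiveRoot_exp (n + 1) n.succ_ne_zero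
  set ω := Complex.exp (2 * Real.pi * Complex.I / (n + 1 : ℕ))
  have hωc : ω * star ω = 1 := by
    have h1 : ‖ω‖ = 1 := hω.norm'_eq_one n.succ_ne_zero
    rw [Complex.star_def, Complex.mul_conj, Complex.normSq_eq_norm_sq, h1]
    simp
  let U : ℕ → Matrix (Fin n) (Fin n) ℂ := fun k => diagonal fun i => (ω ^ (i : ℕ)) ^ k
  have hU : ∀ k, U k ∈ unitaryGroup (Fin n) ℂ := fun k => by
    rw [mem_unitaryGroup_iff, star_eq_conjTranspose, diagonal_conjTranspose, diagonal_mul_diagonal,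
      ← diagonal_one]
    congr 1
    ext i
    simp only [Pi.star_apply, star_pow, ← mul_pow, hωc, one_pow]
  -- Averaging over k multiplies entry (i, j) by the mean of the powers of ω^(i - j), a geometric
  -- sum that vanishes off the diagonal.
  have key : diagonal Y.diag =
      ((n + 1 : ℕ) : ℂ)⁻¹ • ∑ k ∈ Finset.range (n + 1), U k * Y * star (U k) := by
    ext i j
    rw [Matrix.smul_apply, Matrix.sum_apply]
    have hterm : ∀ k, (U k * Y * star (U k)) i j = (ω ^ (i : ℕ) * star ω ^ (j : ℕ)) ^ k * Y i j := by
      intro k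
      rw [star_eq_conjTranspose, diagonal_conjTranspose, mul_diagonal, diagonal_mul]
      simp only [Pi.star_apply, star_pow]
      ring
    simp only [hterm, ← Finset.sum_mul]
    have hn : ((n + 1 : ℕ) : ℂ) ≠ 0 := Nat.cast_ne_zero.2 n.succ_ne_zero
    by_cases hij : i = j
    · subst hij
      simp only [← mul_pow, hωc, one_pow, Finset.sum_const, Finset.card_range, nsmul_eq_mul, mul_one,
        diagonal_apply_eq, diag_apply, smul_eq_mul]
      rw [inv_mul_cancel_left₀ hn]
    · have hz : ω ^ (i : ℕ) * star ω ^ (j : ℕ) - 1 ≠ 0 := by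
        rw [sub_ne_zero]
        intro h
        apply hij
        apply Fin.ext
        refine hω.pow_inj (i.2.trans n.lt_succ_self) (j.2.trans n.lt_succ_self) ?_
        have := congrArg (· * ω ^ (j : ℕ)) h
        simpa only [mul_assoc, ← mul_pow, mul_comm (star ω), hωc, one_pow, mul_one, one_mul]
          using this
      have hgeom := mul_geom_sum (ω ^ (i : ℕ) * star ω ^ (j : ℕ)) (n + 1)
      have h1 : (ω ^ (i : ℕ) * star ω ^ (j : ℕ)) ^ (n + 1) = 1 := by
        rw [mul_pow, ← pow_mul, ← pow_mul, mul_comm (i : ℕ), mul_comm (j : ℕ), pow_mul, pow_mul,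
          ← star_pow, hω.pow_eq_one]
        simp
      rw [h1, sub_self] at hgeom
      rw [(mul_eq_zero.1 hgeom).resolve_left hz, diagonal_apply_ne _ hij]
      simp
  rw [key, N.map_smul]
  have hle := N.map_sum_le (Finset.range (n + 1)) fun k => U k * Y * star (U k)
  simp only [N.map_unitary_mul_mul_unitary' Y (U _) (star (U _)) (hU _) (Unitary.star_mem (hU _)),
    Finset.sum_const, Finset.card_range, nsmul_eq_mul] at hle
  rw [norm_inv, Complex.norm_natCast, inv_mul_le_iff₀ (by positivity)]
  exact hle

end UnitarilyInvariantNorm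

/-! ### Unitary triangularization. -/

namespace Matrix

variable {n : ℕ}

/-- Every invertible matrix becomes unitary after multiplication on the right by a suitable
invertible upper triangular matrix. -/
theorem exists_isUpperTriangular_mul_mem_unitaryGroup {M : Matrix (Fin n) (Fin n) ℂ}
    (hM : IsUnit M) : ∃ E : Matrix (Fin n) (Fin n) ℂ,
      IsUnit E ∧ E.IsUpperTriangular ∧ M * E ∈ unitaryGroup (Fin n) ℂ := by
  -- Gram–Schmidt: if L (M* M) L* = D is diagonal, the columns of M L* D^{-1/2} are orthonormal.
  -- Below, `e` is the diagonal of D^{-1/2}.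
  have hS : (Mᴴ * M).PosDef := PosDef.conjTranspose_mul_self M
    (mulVec_injective_iff_isUnit.2 hM)
  have hL : IsUnit (LDL.lowerInv hS) := isUnit_of_invertible _
  have hD : (LDL.diag hS).PosDef := by
    rw [LDL.diag_eq_lowerInv_conj]
    exact hS.mul_mul_conjTranspose_same (vecMul_injective_iff_isUnit.2 hL)
  have hd : ∀ i, 0 < LDL.diagEntries hS i := posDef_diagonal_iff.1 hD
  have hdr : ∀ i, ((LDL.diagEntries hS i).re : ℂ) = LDL.diagEntries hS i ∧
      0 < (LDL.diagEntries hS i).re := fun i => by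
    have := Complex.pos_iff.1 (hd i)
    exact ⟨Complex.ext rfl (by simp [this.2]), this.1⟩
  let e : Fin n → ℂ := fun i => ((Real.sqrt (LDL.diagEntries hS i).re)⁻¹ : ℝ)
  have he : ∀ i, e i * LDL.diagEntries hS i * e i = 1 := fun i => by
    rw [← (hdr i).1, ← Complex.ofReal_mul, ← Complex.ofReal_mul, ← Complex.ofReal_one]
    congr 1
    have h := Real.sq_sqrt (hdr i).2.le
    have h0 := (Real.sqrt_pos.2 (hdr i).2).ne'
    field_simp
    exact h.symm
  have he0 : ∀ i, e i ≠ 0 := fun i h => by simpa [h] using he i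
  have hstar : star e = e := by
    ext i
    simp [e]
  refine ⟨(LDL.lowerInv hS)ᴴ * diagonal e, ?_, ?_, ?_⟩
  · refine IsUnit.mul ((isUnit_conjTranspose _).2 hL) ?_
    rw [isUnit_diagonal, Pi.isUnit_iff]
    exact fun i => (he0 i).isUnit
  · refine BlockTriangular.mul (fun i j hij => ?_) (blockTriangular_diagonal e)
    rw [conjTranspose_apply, star_eq_zero]
    exact LDL.lowerInv_triangular hS hij
  · rw [mem_unitaryGroup_iff', star_eq_conjTranspose]
    have : (M * ((LDL.lowerInv hS)ᴴ * diagonal e))ᴴ * (M * ((LDL.lowerInv hS)ᴴ * diagonal e)) =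
        diagonal e * (LDL.lowerInv hS * (Mᴴ * M) * (LDL.lowerInv hS)ᴴ) * diagonal e := by
      simp only [conjTranspose_mul, conjTranspose_conjTranspose, diagonal_conjTranspose, hstar,
        Matrix.mul_assoc]
    rw [this, ← LDL.diag_eq_lowerInv_conj, LDL.diag, diagonal_mul_diagonal, diagonal_mul_diagonal,
      ← diagonal_one]
    congr 1
    ext i
    exact he i

theorem IsUpperTriangular.diag_mul {E F : Matrix (Fin n) (Fin n) ℂ}
    (hE : E.IsUpperTriangular) (hF : F.IsUpperTriangular) (i : Fin n) :
    (E * F) i i = E i i * F i i := by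
  rw [mul_apply]
  refine Finset.sum_eq_single i (fun j _ hj => ?_) (by simp)
  rcases lt_or_gt_of_ne hj with h | h
  · rw [hE h, zero_mul]
  · rw [hF h, mul_zero]

theorem IsUpperTriangular.diag_inv_mul_diagonal_mul {E : Matrix (Fin n) (Fin n) ℂ}
    (hE : E.IsUpperTriangular) (hu : IsUnit E) (l : Fin n → ℂ) :
    (E⁻¹ * diagonal l * E).diag = l := by
  let := hu.invertible
  have hi : E⁻¹.IsUpperTriangular := blockTriangular_inv_of_blockTriangular hE
  ext i
  have h1 : E⁻¹ i i * E i i = 1 := by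
    rw [← IsUpperTriangular.diag_mul hi hE, nonsing_inv_mul E ((isUnit_iff_isUnit_det E).1 hu),
      one_apply_eq]
  rw [diag_apply, IsUpperTriangular.diag_mul
    (BlockTriangular.mul hi (blockTriangular_diagonal l)) hE, mul_diagonal, mul_right_comm, h1,
    one_mul]

/-! ### Square roots, the geometric mean and contractions. -/

theorem PosDef.rpow_half_mul_self {A : Matrix (Fin n) (Fin n) ℂ} (hA : A.PosDef) :
    A ^ (1 / 2 : ℝ) * A ^ (1 / 2 : ℝ) = A := by
  rw [← CFC.sqrt_eq_rpow, CFC.sqrt_mul_sqrt_self A hA.posSemidef.nonneg]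

theorem PosDef.rpow_half {A : Matrix (Fin n) (Fin n) ℂ} (hA : A.PosDef) :
    (A ^ (1 / 2 : ℝ)).PosDef := by
  rw [← isStrictlyPositive_iff_posDef, ← CFC.sqrt_eq_rpow]
  exact (isStrictlyPositive_iff_posDef.2 hA).sqrt

theorem PosDef.rpow_neg_half {A : Matrix (Fin n) (Fin n) ℂ} (hA : A.PosDef) :
    A ^ (-(1 / 2) : ℝ) = (A ^ (1 / 2 : ℝ))⁻¹ :=
  (inv_eq_left_inv (CFC.rpow_neg_mul_rpow _ (isStrictlyPositive_iff_posDef.2 hA))).symm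

theorem PosDef.mul_mul_self {P X : Matrix (Fin n) (Fin n) ℂ} (hP : P.PosDef) (hX : X.PosDef) :
    (P * X * P).PosDef := by
  simpa only [hP.isHermitian.eq] using
    hX.mul_mul_conjTranspose_same (vecMul_injective_iff_isUnit.2 hP.isUnit)

theorem PosDef.matGeomMean {A B : Matrix (Fin n) (Fin n) ℂ} (hA : A.PosDef) (hB : B.PosDef) :
    (A ♯ B).PosDef := by
  rw [_root_.matGeomMean, hA.rpow_neg_half]
  exact hA.rpow_half.mul_mul_self (hA.rpow_half.inv.mul_mul_self hB).rpow_half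

/-- The geometric mean solves the Riccati equation `X A⁻¹ X = B`. -/
theorem PosDef.matGeomMean_mul_inv_mul {A B : Matrix (Fin n) (Fin n) ℂ} (hA : A.PosDef)
    (hB : B.PosDef) : (A ♯ B) * A⁻¹ * (A ♯ B) = B := by
  have hp := hA.rpow_half
  have hpp := hA.rpow_half_mul_self
  have hX := (hp.inv.mul_mul_self hB).rpow_half_mul_self
  rw [_root_.matGeomMean, hA.rpow_neg_half]
  set p := A ^ (1 / 2 : ℝ)
  set X := (p⁻¹ * B * p⁻¹) ^ (1 / 2 : ℝ)
  have hu : IsUnit p.det := (isUnit_iff_isUnit_det p).1 hp.isUnit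
  calc p * X * p * A⁻¹ * (p * X * p) = p * (X * X) * p := by
        rw [← hpp, Matrix.mul_inv_rev]
        simp only [Matrix.mul_assoc, mul_nonsing_inv_cancel_left _ _ hu,
          nonsing_inv_mul_cancel_left _ _ hu]
    _ = B := by
        rw [hX]
        simp only [Matrix.mul_assoc, mul_nonsing_inv_cancel_left _ _ hu, nonsing_inv_mul _ hu,
          Matrix.mul_one]

/-- The matrix is (A⁻¹G - Y)* A (A⁻¹G - Y). For fixed Y this bounds G A⁻¹ G below by an expression
linear in (G, A), so such bounds can be added. -/
theorem PosDef.posSemidef_complete_square {A G : Matrix (Fin n) (Fin n) ℂ} (hA : A.PosDef)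
    (hG : G.IsHermitian) (Y : Matrix (Fin n) (Fin n) ℂ) :
    (G * A⁻¹ * G - G * Y - Yᴴ * G + Yᴴ * A * Y).PosSemidef := by
  have hu : IsUnit A.det := (isUnit_iff_isUnit_det A).1 hA.isUnit
  convert hA.posSemidef.conjTranspose_mul_mul_same (A⁻¹ * G - Y) using 1
  rw [conjTranspose_sub, conjTranspose_mul, hA.inv.isHermitian.eq, hG.eq]
  simp only [Matrix.mul_sub, Matrix.sub_mul, Matrix.mul_assoc, mul_nonsing_inv_cancel_left _ _ hu,
    nonsing_inv_mul_cancel_left _ _ hu]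
  abel

/-- Superadditivity of the geometric mean, in terms of the Riccati equation. -/
theorem PosDef.posSemidef_add_sub_matGeomMean {A B C D : Matrix (Fin n) (Fin n) ℂ}
    (hA : A.PosDef) (hB : B.PosDef) (hC : C.PosDef) (hD : D.PosDef) :
    (B + D - (A ♯ B + C ♯ D) * (A + C)⁻¹ * (A ♯ B + C ♯ D)).PosSemidef := by
  have hG := (hA.matGeomMean hB).isHermitian
  have hH := (hC.matGeomMean hD).isHermitian
  have hP : (A + C).PosDef := hA.add hC
  have hu : IsUnit (A + C).det := (isUnit_iff_isUnit_det _).1 hP.isUnit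
  -- The same Y = P⁻¹S, with P = A + C and S the sum of the means, serves both pairs; it turns the
  -- summed lower bound SY + Y*S - Y*PY into S P⁻¹ S.
  have h1 := hA.posSemidef_complete_square hG ((A + C)⁻¹ * (A ♯ B + C ♯ D))
  have h2 := hC.posSemidef_complete_square hH ((A + C)⁻¹ * (A ♯ B + C ♯ D))
  rw [hA.matGeomMean_mul_inv_mul hB] at h1
  rw [hC.matGeomMean_mul_inv_mul hD] at h2
  convert h1.add h2 using 1
  rw [conjTranspose_mul, hP.inv.isHermitian.eq, (hG.add hH).eq]
  set G := A ♯ B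
  set H := C ♯ D
  set Z := (A + C)⁻¹
  have hZ : (G + H) * Z * A * (Z * (G + H)) + (G + H) * Z * C * (Z * (G + H)) =
      (G + H) * Z * (G + H) := by
    rw [← Matrix.add_mul, ← Matrix.mul_add, Matrix.mul_assoc (G + H) Z (A + C),
      nonsing_inv_mul _ hu, Matrix.mul_one, Matrix.mul_assoc]
  have e1 : (G + H) * Z * (G + H) = G * (Z * (G + H)) + H * (Z * (G + H)) := by
    rw [← Matrix.add_mul, Matrix.mul_assoc]
  have e2 : (G + H) * Z * (G + H) = (G + H) * Z * G + (G + H) * Z * H := Matrix.mul_add _ _ _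
  calc B + D - (G + H) * Z * (G + H)
      = B + D - (G + H) * Z * (G + H) - (G + H) * Z * (G + H) + (G + H) * Z * (G + H) := by abel
    _ = B + D - (G * (Z * (G + H)) + H * (Z * (G + H))) - ((G + H) * Z * G + (G + H) * Z * H) +
          ((G + H) * Z * A * (Z * (G + H)) + (G + H) * Z * C * (Z * (G + H))) := by
        rw [hZ, ← e1, ← e2]
    _ = _ := by abel

/-- An invertible contraction is the average of two unitary matrices. -/
theorem exists_unitary_average {D : Matrix (Fin n) (Fin n) ℂ} (hD : IsUnit D)
    (hle : (1 - D * Dᴴ).PosSemidef) :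
    ∃ U ∈ unitaryGroup (Fin n) ℂ, ∃ V ∈ unitaryGroup (Fin n) ℂ, D = (1 / 2 : ℂ) • (U + V) := by
  have hX : (D * Dᴴ).PosDef := PosDef.mul_conjTranspose_self D (vecMul_injective_iff_isUnit.2 hD)
  have hH : (CFC.sqrt (D * Dᴴ)).PosDef :=
    isStrictlyPositive_iff_posDef.1 hX.isStrictlyPositive.sqrt
  have hR : (CFC.sqrt (1 - D * Dᴴ)).PosSemidef :=
    nonneg_iff_posSemidef.1 (CFC.sqrt_nonneg _)
  have hHH : CFC.sqrt (D * Dᴴ) * CFC.sqrt (D * Dᴴ) = D * Dᴴ :=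
    CFC.sqrt_mul_sqrt_self _ hX.posSemidef.nonneg
  have hRR : CFC.sqrt (1 - D * Dᴴ) * CFC.sqrt (1 - D * Dᴴ) = 1 - D * Dᴴ :=
    CFC.sqrt_mul_sqrt_self _ hle.nonneg
  have hc : Commute (CFC.sqrt (D * Dᴴ)) (CFC.sqrt (1 - D * Dᴴ)) := by
    have h0 : Commute (D * Dᴴ) (1 - D * Dᴴ) := (Commute.one_right _).sub_right (Commute.refl _)
    rw [CFC.sqrt_eq_cfc, CFC.sqrt_eq_cfc]
    exact ((h0.cfc_nnreal _).symm.cfc_nnreal _).symm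
  set H := CFC.sqrt (D * Dᴴ)
  set R := CFC.sqrt (1 - D * Dᴴ)
  have hu : IsUnit H.det := (isUnit_iff_isUnit_det H).1 hH.isUnit
  have hW : H⁻¹ * D ∈ unitaryGroup (Fin n) ℂ := by
    rw [mem_unitaryGroup_iff, star_eq_conjTranspose, conjTranspose_mul, hH.inv.isHermitian.eq,
      Matrix.mul_assoc, ← Matrix.mul_assoc D, ← hHH, Matrix.mul_assoc, mul_nonsing_inv _ hu,
      Matrix.mul_one, nonsing_inv_mul _ hu]
  -- Used with c = ±i: H and R commute and H² + R² = 1, so H ± iR are unitary with average H. The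
  -- polar factor H⁻¹D then carries H to D.
  have hU : ∀ c : ℂ, star c = -c → c * c = -1 → H + c • R ∈ unitaryGroup (Fin n) ℂ := by
    intro c hc1 hc2
    rw [mem_unitaryGroup_iff, star_eq_conjTranspose, conjTranspose_add, conjTranspose_smul,
      hH.isHermitian.eq, hR.isHermitian.eq, hc1, Matrix.add_mul, Matrix.mul_add, Matrix.mul_add,
      hHH, Matrix.smul_mul, Matrix.mul_smul, Matrix.smul_mul, Matrix.mul_smul, smul_smul, hRR,
      mul_neg, hc2, hc.eq]
    simp
  refine ⟨(H + Complex.I • R) * (H⁻¹ * D), mul_mem (hU _ (by simp) (by simp)) hW,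
    (H + (-Complex.I) • R) * (H⁻¹ * D), mul_mem (hU _ (by simp) (by simp)) hW, ?_⟩
  rw [← Matrix.add_mul, neg_smul, add_add_add_comm, add_neg_cancel, add_zero, ← two_smul ℂ H,
    Matrix.smul_mul, smul_smul, mul_nonsing_inv_cancel_left _ _ hu]
  norm_num

end Matrix

/-! ### Norm comparisons. -/

namespace UnitarilyInvariantNorm

open Matrix

variable {n : ℕ} (N : UnitarilyInvariantNorm n)

theorem map_mul_contraction_le (K : Matrix (Fin n) (Fin n) ℂ) {D : Matrix (Fin n) (Fin n) ℂ}
    (hD : IsUnit D) (hle : (1 - D * Dᴴ).PosSemidef) : N (K * D) ≤ N K := by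
  obtain ⟨U, hU, V, hV, rfl⟩ := exists_unitary_average hD hle
  rw [Matrix.mul_smul, Matrix.mul_add, N.map_smul]
  have h := N.map_add_le (K * U) (K * V)
  rw [N.map_mul_unitary K hU, N.map_mul_unitary K hV] at h
  have h2 : ‖(1 / 2 : ℂ)‖ = 1 / 2 := by norm_num
  rw [h2]
  linarith

/-- Among all matrices similar to it, a Hermitian matrix has the least norm. -/
theorem map_hermitian_le_map_conj {S p : Matrix (Fin n) (Fin n) ℂ} (hS : S.IsHermitian)
    (hp : IsUnit p) : N S ≤ N (p * S * p⁻¹) := by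
  let V : Matrix (Fin n) (Fin n) ℂ := hS.eigenvectorUnitary
  let l : Fin n → ℂ := fun i => hS.eigenvalues i
  have hV : V ∈ unitaryGroup (Fin n) ℂ := hS.eigenvectorUnitary.2
  have hVV : V⁻¹ = star V := inv_eq_right_inv (mem_unitaryGroup_iff.1 hV)
  have hVu : IsUnit V := IsUnit.of_mul_eq_one _ (mem_unitaryGroup_iff.1 hV)
  have hspec : S = V * diagonal l * star V := by
    conv_lhs => rw [hS.spectral_theorem, Unitary.conjStarAlgAut_apply]
    rfl
  -- With W = pVE unitary, p S p⁻¹ = W (E⁻¹ diag(l) E) W*, whose middle factor is triangular with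
  -- diagonal l.
  obtain ⟨E, hE, hEt, hW⟩ := exists_isUpperTriangular_mul_mem_unitaryGroup (hp.mul hVu)
  have hEu : IsUnit E.det := (isUnit_iff_isUnit_det E).1 hE
  have hWW : (p * V * E)⁻¹ = star (p * V * E) := inv_eq_right_inv (mem_unitaryGroup_iff.1 hW)
  have hT : p * S * p⁻¹ = p * V * E * (E⁻¹ * diagonal l * E) * star (p * V * E) := by
    rw [← hWW, hspec, ← hVV, Matrix.mul_inv_rev, Matrix.mul_inv_rev]
    simp only [Matrix.mul_assoc, mul_nonsing_inv_cancel_left _ _ hEu]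
  rw [hT, N.map_unitary_mul_mul_unitary' _ _ _ hW (Unitary.star_mem hW)]
  calc N S = N (diagonal l) := by
        conv_lhs => rw [hspec]
        exact N.map_unitary_mul_mul_unitary' _ _ _ hV (Unitary.star_mem hV)
    _ ≤ N (E⁻¹ * diagonal l * E) := by
        simpa only [hEt.diag_inv_mul_diagonal_mul hE l] using
          N.map_diagonal_diag_le (E⁻¹ * diagonal l * E)

/-- If `S P⁻¹ S ≤ Q` then the norm of `S` is at most that of `(P^{1/2} Q P^{1/2})^{1/2}`. -/
theorem map_le_map_rpow_half {P Q S : Matrix (Fin n) (Fin n) ℂ} (hP : P.PosDef) (hQ : Q.PosDef)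
    (hS : S.PosDef) (h : (Q - S * P⁻¹ * S).PosSemidef) :
    N S ≤ N ((P ^ (1 / 2 : ℝ) * Q * P ^ (1 / 2 : ℝ)) ^ (1 / 2 : ℝ)) := by
  have hp := hP.rpow_half
  have hpp := hP.rpow_half_mul_self
  set p := P ^ (1 / 2 : ℝ)
  have hK := (hp.mul_mul_self hQ).rpow_half
  have hKK := (hp.mul_mul_self hQ).rpow_half_mul_self
  set K := (p * Q * p) ^ (1 / 2 : ℝ)
  have hpu : IsUnit p.det := (isUnit_iff_isUnit_det p).1 hp.isUnit
  have hKu : IsUnit K.det := (isUnit_iff_isUnit_det K).1 hK.isUnit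
  refine (N.map_hermitian_le_map_conj hS.isHermitian hp.isUnit).trans ?_
  have hT : p * S * p⁻¹ = K * (K⁻¹ * (p * S * p⁻¹)) := (mul_nonsing_inv_cancel_left _ _ hKu).symm
  rw [hT]
  refine N.map_mul_contraction_le K
    (hK.inv.isUnit.mul ((hp.isUnit.mul hS.isUnit).mul hp.inv.isUnit)) ?_
  -- Conjugating Q - S P⁻¹ S ≥ 0 by K⁻¹p gives 1 - (K⁻¹T)(K⁻¹T)* ≥ 0 for T = p S p⁻¹, because K⁻¹ p
  -- Q p K⁻¹ = 1.
  convert (h.mul_mul_conjTranspose_same p).mul_mul_conjTranspose_same K⁻¹ using 1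
  have h1 : K⁻¹ * (p * Q * p) * K⁻¹ = 1 := by
    rw [← hKK, nonsing_inv_mul_cancel_left _ _ hKu, mul_nonsing_inv _ hKu]
  simp only [conjTranspose_mul, hp.isHermitian.eq, hp.inv.isHermitian.eq, hK.inv.isHermitian.eq,
    hS.isHermitian.eq, Matrix.mul_sub, Matrix.sub_mul]
  rw [h1, ← hpp, Matrix.mul_inv_rev]
  simp only [Matrix.mul_assoc]

end UnitarilyInvariantNorm

theorem theoremA340 (n : ℕ) (A B C D : Matrix (Fin n) (Fin n) ℂ)
    (hA : A.PosDef) (hB : B.PosDef) (hC : C.PosDef) (hD : D.PosDef)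
    (N : UnitarilyInvariantNorm n) :
    N (A ♯ B + C ♯ D) ≤
      N (((A + C) ^ (1 / 2 : ℝ) * (B + D) * (A + C) ^ (1 / 2 : ℝ)) ^ (1 / 2 : ℝ)) :=
  N.map_le_map_rpow_half (hA.add hC) (hB.add hD) ((hA.matGeomMean hB).add (hC.matGeomMean hD))
    (hA.posSemidef_add_sub_matGeomMean hB hC hD)
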